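/- Let $n\ge 3$ and $(p_1,p_2)=(0.7,0.3)$. For score vectors $a=(a_1,\dots,a_n)$, $b=(b_1,\dots,b_n)$ with $a_1=b_1=1$ and positive entries put $$\eta_{i,j}(a,b)=p_1\frac{a_i}{a_i+a_j}+p_2\frac{b_i}{b_i+b_j}\quad(i\neq j),\qquad \eta_{i,j,k}(a,b)=p_1\frac{a_i}{a_i+a_j+a_k}+p_2\frac{b_i}{b_i+b_j+b_k}\quad(i,j,k\text{ pairwise distinct}),$$ the probabilities that a mixture of two multinomial logit (MNL) models selects item $i$ from the slates $\{i,j\}$ and $\{i,j,k\}$. Let $Q=\prod_{l=1}^{2n-2}[r_l,R_l]\subseteq\mathbb R^{2n-2}$ with $0<r_l<R_l$ for all $l$ be the domain of the parameters $(a_{2:n},b_{2:n})$. Then for all $(a_{2:n},b_{2:n})\in Q$ outside a set of $(2n-2)$-dimensional Lebesgue measure zero, the system $$\begin{cases}x_1=y_1=1,\\ p_1\dfrac{x_i}{x_i+x_j}+p_2\dfrac{y_i}{y_i+y_j}=\eta_{i,j}(a,b), & i\ne j\in[n],\\[1ex] p_1\dfrac{x_i}{x_i+x_j+x_k}+p_2\dfrac{y_i}{y_i+y_j+y_k}=\eta_{i,j,k}(a,b),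 & i,j,k\in[n]\text{ pairwise distinct},\end{cases}$$ in unknowns $x,y\in\mathbb C^n$ (all denominators being nonzero) has exactly one complex solution counted with multiplicity, namely $(x,y)=(a,b)$; that is, $(a,b)$ is its only solution and has multiplicity one. Here the multiplicity of a solution $z$ is $\dim_{\mathbb C}\mathcal O_z/I\mathcal O_z$, where $\mathcal O_z$ is the local ring of $\mathbb C^{2n}$ at $z$ and $I$ is the ideal generated by the equations after clearing denominators. Consequently the mixture is generically identifiable on $Q$: $Q$ has positive Lebesgue measure, and the set of $(a_{2:n},b_{2:n})\in Q$ for which some other $(a^{\#}_{2:n},b^{\#}_{2:n})\in Q$ (with $a^{\#}_1=b^{\#}_1=1$) satisfies $\eta_{i,j}(a^{\#},b^{\#})=\eta_{i,j}(a,b)$ for all $i\ne j$ and $\eta_{i,j,k}(a^{\#},b^{\#})=\eta_{i,j,k}(a,b)$ for all pairwise distinct $i,j,k$ has Lebesgue measure zero. -/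

import Mathlib

open MeasureTheory

namespace MNLMixture

/-- The full score vector `(1, v₂, …, vₙ)` with `n = m + 1` items, normalized so that the
first item (index `0`) has score `1`. -/
def scores {R : Type*} [One R] {m : ℕ} (v : Fin m → R) : Fin (m + 1) → R :=
  Fin.cons 1 v

/-- `η_{i,j}`: the probability that item `i` is chosen from the slate `{i, j}`. -/
noncomputable def eta₂ {n : ℕ} (p₁ p₂ : ℝ) (a b : Fin n → ℝ) (i j : Fin n) : ℝ :=
  p₁ * (a i / (a i + a j)) + p₂ * (b i / (b i + b j))

/-- `η_{i,j,k}`: the probability that item `i` is chosen from the slate `{i, j, k}`. -/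
noncomputable def eta₃ {n : ℕ} (p₁ p₂ : ℝ) (a b : Fin n → ℝ) (i j k : Fin n) : ℝ :=
  p₁ * (a i / (a i + a j + a k)) + p₂ * (b i / (b i + b j + b k))

/-- `i`, `j`, `k` are pairwise distinct, i.e. `{i, j, k}` is a slate of size three. -/
def Distinct₃ {n : ℕ} (i j k : Fin n) : Prop :=
  i ≠ j ∧ i ≠ k ∧ j ≠ k

/-- `(x, y)` is a complex solution of the system with known mixing probabilities `p₁, p₂` and
observed slate probabilities `η₂`, `η₃`. All the fractions of the system are required to make
sense, i.e. no denominator vanishes. -/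
structure IsSolution {m : ℕ} (p₁ p₂ : ℝ) (η₂ : Fin (m + 1) → Fin (m + 1) → ℝ)
    (η₃ : Fin (m + 1) → Fin (m + 1) → Fin (m + 1) → ℝ) (x y : Fin (m + 1) → ℂ) : Prop where
  x_first : x 0 = 1
  y_first : y 0 = 1
  x_pair_ne : ∀ i j, i ≠ j → x i + x j ≠ 0
  y_pair_ne : ∀ i j, i ≠ j → y i + y j ≠ 0
  x_triple_ne : ∀ i j k, Distinct₃ i j k → x i + x j + x k ≠ 0
  y_triple_ne : ∀ i j k, Distinct₃ i j k → y i + y j + y k ≠ 0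
  pair : ∀ i j, i ≠ j →
    (p₁ : ℂ) * (x i / (x i + x j)) + (p₂ : ℂ) * (y i / (y i + y j)) = (η₂ i j : ℂ)
  triple : ∀ i j k, Distinct₃ i j k →
    (p₁ : ℂ) * (x i / (x i + x j + x k)) + (p₂ : ℂ) * (y i / (y i + y j + y k)) = (η₃ i j k : ℂ)

section Multiplicity

open MvPolynomial

/-- The maximal ideal `𝔪_z` of the polynomials that vanish at `z`. -/
noncomputable def idealAt {σ : Type*} (z : σ → ℂ) : Ideal (MvPolynomial σ ℂ) :=
  RingHom.ker (eval z)

instance idealAt_isPrime {σ : Type*} (z : σ → ℂ) : (idealAt z).IsPrime :=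
  RingHom.ker_isPrime (eval z)

/-- The multiplicity of the point `z` as a solution of the polynomial equations `f = 0`, `f ∈ I`:
the dimension over `ℂ` of the local ring at `z` of the scheme defined by `I`, that is, of
`ℂ[X]_{𝔪_z} / I ℂ[X]_{𝔪_z}`. -/
noncomputable def solutionMultiplicity {σ : Type*} (I : Ideal (MvPolynomial σ ℂ)) (z : σ → ℂ) :
    ℕ∞ :=
  Cardinal.toENat (Module.rank ℂ
    (Localization.AtPrime (idealAt z) ⧸
      I.map (algebraMap (MvPolynomial σ ℂ) (Localization.AtPrime (idealAt z)))))

/-- The variable `x_i`. -/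
noncomputable def varX {n : ℕ} (i : Fin n) : MvPolynomial (Fin n ⊕ Fin n) ℂ := X (Sum.inl i)

/-- The variable `y_i`. -/
noncomputable def varY {n : ℕ} (i : Fin n) : MvPolynomial (Fin n ⊕ Fin n) ℂ := X (Sum.inr i)

/-- The polynomial
`p₁ x_i (y_i + y_j) + p₂ y_i (x_i + x_j) - η (x_i + x_j)(y_i + y_j)`, obtained from the
equation of the slate `{i, j}` by multiplying with its denominators. -/
noncomputable def pairPoly {n : ℕ} (p₁ p₂ : ℝ) (η : ℝ) (i j : Fin n) :
    MvPolynomial (Fin n ⊕ Fin n) ℂ :=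
  C (p₁ : ℂ) * varX i * (varY i + varY j) + C (p₂ : ℂ) * varY i * (varX i + varX j)
    - C (η : ℂ) * (varX i + varX j) * (varY i + varY j)

/-- The polynomial
`p₁ x_i (y_i + y_j + y_k) + p₂ y_i (x_i + x_j + x_k) - η (x_i + x_j + x_k)(y_i + y_j + y_k)`,
obtained from the equation of the slate `{i, j, k}` by multiplying with its denominators. -/
noncomputable def triplePoly {n : ℕ} (p₁ p₂ : ℝ) (η : ℝ) (i j k : Fin n) :
    MvPolynomial (Fin n ⊕ Fin n) ℂ :=
  C (p₁ : ℂ) * varX i * (varY i + varY j + varY k)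
    + C (p₂ : ℂ) * varY i * (varX i + varX j + varX k)
    - C (η : ℂ) * (varX i + varX j + varX k) * (varY i + varY j + varY k)

/-- The ideal of the system after clearing denominators. At a solution of the system every
denominator is a unit of the local ring of the affine space, so there this ideal and the original
rational equations generate the same ideal of the local ring, and adjoining an inverse for each
denominator as a new variable does not change the local ring of the solution scheme either. -/
noncomputable def systemIdeal {m : ℕ} (p₁ p₂ : ℝ) (η₂ : Fin (m + 1) → Fin (m + 1) → ℝ)
    (η₃ : Fin (m + 1) → Fin (m + 1) → Fin (m + 1) → ℝ) :
    Ideal (MvPolynomial (Fin (m + 1) ⊕ Fin (m + 1)) ℂ) :=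
  Ideal.span
    ({varX 0 - 1, varY 0 - 1}
      ∪ {f | ∃ i j, i ≠ j ∧ f = pairPoly p₁ p₂ (η₂ i j) i j}
      ∪ {f | ∃ i j k, Distinct₃ i j k ∧ f = triplePoly p₁ p₂ (η₃ i j k) i j k})

end Multiplicity

/-- The system with data `η₂`, `η₃` has `(x, y)` as its unique complex solution, counted with
multiplicity: no other solution exists and `(x, y)` has multiplicity one. -/
def UniqueSolutionWithMultiplicity {m : ℕ} (p₁ p₂ : ℝ) (η₂ : Fin (m + 1) → Fin (m + 1) → ℝ)
    (η₃ : Fin (m + 1) → Fin (m + 1) → Fin (m + 1) → ℝ) (x y : Fin (m + 1) → ℂ) : Prop :=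
  {z : (Fin (m + 1) → ℂ) × (Fin (m + 1) → ℂ) | IsSolution p₁ p₂ η₂ η₃ z.1 z.2} = {(x, y)} ∧
    solutionMultiplicity (systemIdeal p₁ p₂ η₂ η₃) (Sum.elim x y) = 1

/-- The box `Q = ∏ [r_i, R_i]` of the parameters `(a_{2:n}, b_{2:n})`, the bounds for the
`a`-block being `rA, RA` and those for the `b`-block `rB, RB`. -/
def box {m : ℕ} (rA RA rB RB : Fin m → ℝ) : Set ((Fin m → ℝ) × (Fin m → ℝ)) :=
  Set.Icc rA RA ×ˢ Set.Icc rB RB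

/-- The non-identifiable parameters in `Q`: those `(a_{2:n}, b_{2:n})` for which some other
parameter in `Q` produces the same 2-slate and 3-slate probabilities. -/
def nonIdentifiable {m : ℕ} (p₁ p₂ : ℝ) (Q : Set ((Fin m → ℝ) × (Fin m → ℝ))) :
    Set ((Fin m → ℝ) × (Fin m → ℝ)) :=
  {θ ∈ Q | ∃ θ' ∈ Q, θ' ≠ θ ∧
    (∀ i j, i ≠ j → eta₂ p₁ p₂ (scores θ'.1) (scores θ'.2) i j =
      eta₂ p₁ p₂ (scores θ.1) (scores θ.2) i j) ∧
    (∀ i j k, Distinct₃ i j k → eta₃ p₁ p₂ (scores θ'.1) (scores θ'.2) i j k =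
      eta₃ p₁ p₂ (scores θ.1) (scores θ.2) i j k)}

/-- Generic identifiability on `Q`: the parameter set has positive Lebesgue measure and the
non-identifiable parameters form a set of Lebesgue measure zero. -/
def GenericallyIdentifiable {m : ℕ} (p₁ p₂ : ℝ) (Q : Set ((Fin m → ℝ) × (Fin m → ℝ))) : Prop :=
  0 < volume Q ∧ volume (nonIdentifiable p₁ p₂ Q) = 0

end MNLMixture

/-! Three items, the first item together with `j` and `k`, already determine the scores of item `j`.
Divide `x` and `y` by their sums over this slate, and call the results `X`, `Y` and the true values
`A`, `B`. The equations of the slate of size three become linear, `7 X + 3 Y = 7 A + 3 B`, so `Y = B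
- (7/3) d` with `d = X - A`. The entries of `d` sum to zero, which leaves two unknowns. Each of the
three slates of size two then says that `d` lies on a conic through the origin (`slate_equation`).

Write the conics as `L + Q`, linear plus quadratic part. At a common point of two of them, `L_e Q_f
- L_f Q_e = 0`, a homogeneous cubic. Three conics give two such binary cubics, and if their Bezout
determinant is nonzero then `d = 0` (`eq_zero_of_conics`). This is uniqueness.

For the multiplicity, the same algebra is run in the local ring of the solution scheme, where `d`
lies in the maximal ideal. If two of the conics have nonzero Jacobian at the origin, then again `d =
0` (`eq_zero_of_conics_of_mem_maximalIdeal`). All coordinates are then constants and the local ring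
is `ℂ`.

The product of the Jacobian and the Bezout determinant is a polynomial in the true scores. It is
nonzero at one sample point, so the degenerate parameters form a null set. Identifiability follows
because a competing parameter in the box would be a second complex solution. -/

namespace MNLMixture

/-! ### Zero sets of real polynomials are null. -/

section ZeroSet

open MvPolynomial

/-- The zero set of a nonzero real polynomial in `n` variables is Lebesgue-null. -/
theorem volume_zeros_fin {n : ℕ} (P : MvPolynomial (Fin n) ℝ) (hP : P ≠ 0) :
    volume {v : Fin n → ℝ | eval v P = 0} = 0 := by
  induction n with
  | zero =>
    obtain ⟨v, hv⟩ : ∃ v, eval v P ≠ 0 := by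
      by_contra! h
      exact hP (MvPolynomial.funext fun v => by simpa using h v)
    have : {v : Fin 0 → ℝ | eval v P = 0} = ∅ := by
      ext w
      simpa [Subsingleton.elim w v] using hv
    rw [this, measure_empty]
  | succ n ih =>
    have hQ : finSuccEquiv ℝ n P ≠ 0 := by simpa using hP
    obtain ⟨i, hi⟩ : ∃ i, (finSuccEquiv ℝ n P).coeff i ≠ 0 := by
      by_contra! h
      exact hQ (Polynomial.ext (by simpa using h))
    -- By induction one coefficient in the first variable is nonzero for almost every `s`. For such
    -- `s` the slice is the finite root set of a nonzero univariate polynomial, and Fubini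
    -- concludes.
    have hae : ∀ᵐ s : Fin n → ℝ, eval s ((finSuccEquiv ℝ n P).coeff i) ≠ 0 := by
      rw [ae_iff]
      simpa using ih _ hi
    have hclosed : IsClosed {v : Fin (n + 1) → ℝ | eval v P = 0} :=
      isClosed_eq (MvPolynomial.continuous_eval P) continuous_const
    have hmp := (volume_preserving_piFinSuccAbove (fun _ : Fin (n + 1) => ℝ) 0).symm
    rw [← hmp.measure_preimage hclosed.measurableSet.nullMeasurableSet]
    rw [Measure.volume_eq_prod, Measure.prod_apply_symm (hmp.measurable hclosed.measurableSet)]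
    refine (lintegral_congr_ae ?_).trans lintegral_zero
    filter_upwards [hae] with s hs
    have hne : Polynomial.map (eval s) (finSuccEquiv ℝ n P) ≠ 0 := fun h => hs <| by
      simpa using congrArg (fun q => q.coeff i) h
    refine (Set.Finite.subset (Polynomial.map (eval s) (finSuccEquiv ℝ n P)).roots.toFinset.finite_toSet
      fun y hy => ?_).measure_zero volume
    have hy' : eval (Fin.cons y s : Fin (n + 1) → ℝ) P = 0 := by
      simpa [MeasurableEquiv.piFinSuccAbove, Fin.insertNthEquiv, Fin.insertNth_zero] using hy
    rw [eval_eq_eval_mv_eval'] at hy'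
    simpa [hne, Polynomial.IsRoot] using hy'

/-- The zero set of a nonzero real polynomial in finitely many variables is Lebesgue-null. -/
theorem volume_zeros {σ : Type*} [Fintype σ] (P : MvPolynomial σ ℝ) (hP : P ≠ 0) :
    volume {v : σ → ℝ | eval v P = 0} = 0 := by
  let e := (Fintype.equivFin σ).symm
  have hmp := volume_measurePreserving_piCongrLeft (fun _ : σ => ℝ) e
  have hclosed : IsClosed {v : σ → ℝ | eval v P = 0} :=
    isClosed_eq (MvPolynomial.continuous_eval P) continuous_const
  rw [← hmp.measure_preimage hclosed.measurableSet.nullMeasurableSet]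
  have h0 : rename e.symm P ≠ 0 := by
    rwa [Ne, ← map_zero (rename e.symm), (rename_injective _ e.symm.injective).eq_iff]
  convert volume_zeros_fin _ h0 using 2
  ext v
  simp only [Set.mem_preimage, Set.mem_ofPred_eq, eval_rename]
  have : (MeasurableEquiv.piCongrLeft (fun _ : σ => ℝ) e) v = v ∘ e.symm := by
    ext i
    obtain ⟨j, rfl⟩ := e.surjective i
    simp [MeasurableEquiv.coe_piCongrLeft]
  rw [this]

/-- The same on a product `(σ → ℝ) × (τ → ℝ)`. -/
theorem volume_zeros_prod {σ τ : Type*} [Fintype σ] [Fintype τ]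
    (P : MvPolynomial (σ ⊕ τ) ℝ) (hP : P ≠ 0) :
    volume {θ : (σ → ℝ) × (τ → ℝ) | eval (Sum.elim θ.1 θ.2) P = 0} = 0 := by
  have hmp := volume_measurePreserving_sumPiEquivProdPi_symm (fun _ : σ ⊕ τ => ℝ)
  have hclosed : IsClosed {v : σ ⊕ τ → ℝ | eval v P = 0} :=
    isClosed_eq (MvPolynomial.continuous_eval P) continuous_const
  rw [← volume_zeros P hP, ← hmp.measure_preimage hclosed.measurableSet.nullMeasurableSet]
  congr 1


end ZeroSet

/-! ### Elimination for conics through the origin, and the conics of the slates. -/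

section Conics

/-- The Bezout determinant of two binary cubics. -/
def bezoutCubic {R : Type*} [CommRing R] (c d : Fin 4 → R) : R :=
  let w := fun i j => c i * d j - c j * d i
  (Matrix.of ![![w 0 1, w 0 2, w 0 3], ![w 0 2, w 0 3 + w 1 2, w 1 3],
    ![w 0 3, w 1 3, w 2 3]]).det

/-- Two binary cubics with nonzero Bezout determinant have no common zero. -/
theorem eq_zero_of_bezoutCubic_ne_zero {K : Type*} [Field K] (c d : Fin 4 → K)
    (h : bezoutCubic c d ≠ 0) (s t : K)
    (hc : c 0 * s ^ 3 + c 1 * s ^ 2 * t + c 2 * s * t ^ 2 + c 3 * t ^ 3 = 0)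
    (hd : d 0 * s ^ 3 + d 1 * s ^ 2 * t + d 2 * s * t ^ 2 + d 3 * t ^ 3 = 0) :
    s = 0 ∧ t = 0 := by
  simp only [bezoutCubic, Matrix.det_fin_three, Matrix.of_apply, Matrix.cons_val] at h
  by_cases ht : t = 0
  · refine ⟨?_, ht⟩
    by_contra hs
    have hs3 : s ^ 3 ≠ 0 := pow_ne_zero _ hs
    subst ht
    have h0 : c 0 = 0 := by simpa [hs3] using hc
    have h1 : d 0 = 0 := by simpa [hs3] using hd
    -- With both leading coefficients zero, the first row of the Bezout matrix vanishes.
    exact h (by rw [h0, h1]; ring)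
  · exfalso
    -- `r0`, `r1`, `r2` say that the Bezout matrix kills the vector `(s², st, t²)`. Each is a
    -- combination of the two cubics divided by a power of `t`.
    have r0 : (c 0 * d 1 - c 1 * d 0) * s ^ 2 + (c 0 * d 2 - c 2 * d 0) * (s * t)
        + (c 0 * d 3 - c 3 * d 0) * t ^ 2 = 0 := by
      apply mul_left_cancel₀ ht
      linear_combination c 0 * hd - d 0 * hc
    have r1 : (c 0 * d 2 - c 2 * d 0) * s ^ 2
        + (c 0 * d 3 - c 3 * d 0 + (c 1 * d 2 - c 2 * d 1)) * (s * t)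
        + (c 1 * d 3 - c 3 * d 1) * t ^ 2 = 0 := by
      apply mul_left_cancel₀ (pow_ne_zero 2 ht)
      linear_combination (c 0 * s + c 1 * t) * hd - (d 0 * s + d 1 * t) * hc
    have r2 : (c 0 * d 3 - c 3 * d 0) * s ^ 2 + (c 1 * d 3 - c 3 * d 1) * (s * t)
        + (c 2 * d 3 - c 3 * d 2) * t ^ 2 = 0 := by
      apply mul_left_cancel₀ (pow_ne_zero 3 ht)
      linear_combination (c 0 * s ^ 2 + c 1 * s * t + c 2 * t ^ 2) * hd
        - (d 0 * s ^ 2 + d 1 * s * t + d 2 * t ^ 2) * hc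
    apply h
    apply mul_right_cancel₀ (pow_ne_zero 2 ht)
    generalize c 0 * d 1 - c 1 * d 0 = m1 at *
    generalize c 0 * d 2 - c 2 * d 0 = m2 at *
    generalize c 0 * d 3 - c 3 * d 0 = m3 at *
    generalize c 1 * d 2 - c 2 * d 1 = m4 at *
    generalize c 1 * d 3 - c 3 * d 1 = m5 at *
    generalize c 2 * d 3 - c 3 * d 2 = m6 at *
    -- The multipliers are the cofactors of the last column, as in Cramer's rule for `t²`.
    linear_combination (m2 * m5 - m3 * (m3 + m4)) * r0 - (m1 * m5 - m2 * m3) * r1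
      + (m1 * (m3 + m4) - m2 ^ 2) * r2

/-- The conic `e₀ s + e₁ t + e₂ s² + e₃ s t + e₄ t²`, which passes through the origin. -/
def conic {R : Type*} [CommRing R] (e : Fin 5 → R) (s t : R) : R :=
  e 0 * s + e 1 * t + e 2 * s ^ 2 + e 3 * (s * t) + e 4 * t ^ 2

/-- The coefficients of the binary cubic `L_e Q_f - L_f Q_e`, where `L` and `Q` are the linear
and the quadratic part of a conic through the origin. -/
def conicMinor {R : Type*} [CommRing R] (e f : Fin 5 → R) : Fin 4 → R :=
  ![e 0 * f 2 - f 0 * e 2, e 0 * f 3 + e 1 * f 2 - f 0 * e 3 - f 1 * e 2,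
    e 0 * f 4 + e 1 * f 3 - f 0 * e 4 - f 1 * e 3, e 1 * f 4 - f 1 * e 4]

/-- On both conics `Q = -L`, so `L_e Q_f - L_f Q_e` cancels. -/
theorem conicMinor_eval_eq_zero {R : Type*} [CommRing R] (e f : Fin 5 → R) (s t : R)
    (he : conic e s t = 0) (hf : conic f s t = 0) :
    conicMinor e f 0 * s ^ 3 + conicMinor e f 1 * s ^ 2 * t + conicMinor e f 2 * s * t ^ 2
      + conicMinor e f 3 * t ^ 3 = 0 := by
  simp only [conic] at he hf
  simp only [conicMinor, Matrix.cons_val]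
  linear_combination (e 0 * s + e 1 * t) * hf - (f 0 * s + f 1 * t) * he

/-- The deviation `d` of normalized scores from the true ones satisfies, for the slate `{i, j}`,
`L d_i + L' d_k + d_k (M d_i + M' d_k) = 0`; these are `L, L', M, M'`. -/
def slateCoeff {R : Type*} [CommRing R] (ai aj ak bi bj bk : R) : Fin 4 → R :=
  ![3 * ((ai + aj + ak) * (bi + bj) - (bi + bj + bk) * (ai + aj)) * ((ai + aj) * (bi + bj)),
    3 * (ai * (bi + bj) ^ 2 * (ai + aj + ak) - bi * (ai + aj) ^ 2 * (bi + bj + bk)),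
    10 * ((ai + aj + ak) * (bi + bj + bk)) * ((ai + aj) * (bi + bj)),
    (ai + aj + ak) * (bi + bj + bk) * (7 * ai * (bi + bj) + 3 * bi * (ai + aj))]

/-- The conics in `(d₁, d₂)` of the three slates of size two, for the scores `(1, a₁, a₂)` and
`(1, b₁, b₂)`; here `d₀ = -(d₁ + d₂)`. -/
def slateConic {R : Type*} [CommRing R] (a₁ a₂ b₁ b₂ : R) : Fin 3 → Fin 5 → R :=
  let u := slateCoeff a₁ a₂ 1 b₁ b₂ 1
  let v := slateCoeff a₂ 1 a₁ b₂ 1 b₁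
  let w := slateCoeff a₁ 1 a₂ b₁ 1 b₂
  ![![u 0 - u 1, -u 1, u 3 - u 2, 2 * u 3 - u 2, u 3],
    ![v 1, v 0, v 3, v 2, 0],
    ![w 0, w 1, 0, w 2, w 3]]

/-- The Jacobian determinant at the origin of the conics of the slates `{0, 2}` and `{0, 1}`. -/
def jacobian {R : Type*} [CommRing R] (a₁ a₂ b₁ b₂ : R) : R :=
  slateConic a₁ a₂ b₁ b₂ 1 0 * slateConic a₁ a₂ b₁ b₂ 2 1
    - slateConic a₁ a₂ b₁ b₂ 1 1 * slateConic a₁ a₂ b₁ b₂ 2 0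

/-- A polynomial in the scores whose zeros contain all degenerate parameters. -/
def degeneracy {R : Type*} [CommRing R] (a₁ a₂ b₁ b₂ : R) : R :=
  jacobian a₁ a₂ b₁ b₂ *
    bezoutCubic (conicMinor (slateConic a₁ a₂ b₁ b₂ 1) (slateConic a₁ a₂ b₁ b₂ 2))
      (conicMinor (slateConic a₁ a₂ b₁ b₂ 1) (slateConic a₁ a₂ b₁ b₂ 0))

/-- This and the next lemmas give compatibility with ring homomorphisms: the degeneracy is needed as
a formal polynomial, as a real number and as a complex number. -/
theorem map_bezoutCubic {R S : Type*} [CommRing R] [CommRing S] (φ : R →+* S) (c d : Fin 4 → R) :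
    φ (bezoutCubic c d) = bezoutCubic (φ ∘ c) (φ ∘ d) := by
  simp [bezoutCubic, Matrix.det_fin_three]

theorem map_conicMinor {R S : Type*} [CommRing R] [CommRing S] (φ : R →+* S) (e f : Fin 5 → R) :
    φ ∘ conicMinor e f = conicMinor (φ ∘ e) (φ ∘ f) := by
  ext i
  fin_cases i <;> simp [conicMinor]

theorem map_slateCoeff {R S : Type*} [CommRing R] [CommRing S] (φ : R →+* S)
    (ai aj ak bi bj bk : R) (l : Fin 4) :
    φ (slateCoeff ai aj ak bi bj bk l) =
      slateCoeff (φ ai) (φ aj) (φ ak) (φ bi) (φ bj) (φ bk) l := by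
  fin_cases l <;> simp [slateCoeff, map_ofNat]

theorem map_slateConic {R S : Type*} [CommRing R] [CommRing S] (φ : R →+* S)
    (a₁ a₂ b₁ b₂ : R) (k : Fin 3) :
    φ ∘ slateConic a₁ a₂ b₁ b₂ k = slateConic (φ a₁) (φ a₂) (φ b₁) (φ b₂) k := by
  ext l
  fin_cases k <;> fin_cases l <;> simp [slateConic, map_slateCoeff, map_ofNat]

theorem map_jacobian {R S : Type*} [CommRing R] [CommRing S] (φ : R →+* S) (a₁ a₂ b₁ b₂ : R) :
    φ (jacobian a₁ a₂ b₁ b₂) = jacobian (φ a₁) (φ a₂) (φ b₁) (φ b₂) := by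
  simp only [jacobian, map_sub, map_mul, ← map_slateConic, Function.comp_apply]

theorem map_degeneracy {R S : Type*} [CommRing R] [CommRing S] (φ : R →+* S) (a₁ a₂ b₁ b₂ : R) :
    φ (degeneracy a₁ a₂ b₁ b₂) = degeneracy (φ a₁) (φ a₂) (φ b₁) (φ b₂) := by
  simp only [degeneracy, map_mul, map_jacobian, map_bezoutCubic, map_conicMinor, map_slateConic]

/-- The sample scores need not be positive, since only the nonvanishing of the polynomial is at
stake; the zeros keep the arithmetic small. -/
theorem degeneracy_sample_ne_zero : degeneracy (1 : ℝ) 0 0 1 ≠ 0 := by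
  have h0 : slateConic (1 : ℝ) 0 0 1 0 = ![-6, -6, -12, 16, 28] := by
    ext l; fin_cases l <;> simp [slateConic, slateCoeff] <;> norm_num
  have h1 : slateConic (1 : ℝ) 0 0 1 1 = ![-6, 12, 12, 80, 0] := by
    ext l; fin_cases l <;> simp [slateConic, slateCoeff] <;> norm_num
  have h2 : slateConic (1 : ℝ) 0 0 1 2 = ![-12, 6, 0, 80, 28] := by
    ext l; fin_cases l <;> simp [slateConic, slateCoeff] <;> norm_num
  simp only [degeneracy, jacobian, bezoutCubic, Matrix.det_fin_three, h0, h1, h2, conicMinor,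
    Matrix.of_apply, Matrix.cons_val]
  norm_num

/-- Substituting `Y = B - (7/3) d`, the equation of the slate `{i, j}` is a conic in `d`. -/
theorem slate_equation {R : Type*} [CommRing R] [Algebra ℂ R]
    {ai aj ak bi bj bk sa sb : ℂ} (hSa : ai + aj + ak = sa) (hSb : bi + bj + bk = sb)
    (hsa : sa ≠ 0) (hsb : sb ≠ 0) (ha : ai + aj ≠ 0) (hb : bi + bj ≠ 0)
    {Xi Xj Xk Yi Yj Yk : R} (hX : Xi + Xj + Xk = 1) (hY : Yi + Yj + Yk = 1)
    (hi : algebraMap ℂ R (7 / 10) * Xi + algebraMap ℂ R (3 / 10) * Yi =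
      algebraMap ℂ R (7 / 10 * (ai / sa) + 3 / 10 * (bi / sb)))
    (hk : algebraMap ℂ R (7 / 10) * Xk + algebraMap ℂ R (3 / 10) * Yk =
      algebraMap ℂ R (7 / 10 * (ak / sa) + 3 / 10 * (bk / sb)))
    (hij : algebraMap ℂ R (7 / 10) * Xi * (Yi + Yj) + algebraMap ℂ R (3 / 10) * Yi * (Xi + Xj) =
      algebraMap ℂ R (7 / 10 * (ai / (ai + aj)) + 3 / 10 * (bi / (bi + bj)))
        * (Xi + Xj) * (Yi + Yj)) :
    let c := fun l => algebraMap ℂ R (slateCoeff ai aj ak bi bj bk l)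
    let di := Xi - algebraMap ℂ R (ai / sa)
    let dk := Xk - algebraMap ℂ R (ak / sa)
    c 0 * di + c 1 * dk + dk * (c 2 * di + c 3 * dk) = 0 := by
  intro c di dk
  subst hSa hSb
  set f := algebraMap ℂ R with hf
  have e7 : f (7 / 10) = f (1 / 10) * 7 := by
    rw [← map_ofNat f 7, ← map_mul]; norm_num
  have e3 : f (3 / 10) = f (1 / 10) * 3 := by
    rw [← map_ofNat f 3, ← map_mul]; norm_num
  have e10 : f (1 / 10) * 10 = 1 := by
    rw [← map_ofNat f 10, ← map_mul]; norm_num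
  have e71 : f (1 / 7) * 7 = 1 := by
    rw [← map_ofNat f 7, ← map_mul]; norm_num
  -- `N` is the common denominator that makes the coefficients of the conic polynomial in the
  -- scores.
  set N := (ai + aj + ak) * (bi + bj + bk) * ((ai + aj) * (bi + bj)) with hN
  set u := ai / (ai + aj) with hu
  set v := bi / (bi + bj) with hv
  have c0 : c 0 = f (N * (3 * ((1 - bk / (bi + bj + bk)) - (1 - ak / (ai + aj + ak))))) := by
    simp only [c, slateCoeff, Matrix.cons_val]
    congr 1; rw [hN]; field_simp; ring
  have c1 : c 1 = f (N * (3 * (u * (1 - bk / (bi + bj + bk)) - v * (1 - ak / (ai + aj + ak))))) := by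
    simp only [c, slateCoeff, Matrix.cons_val]
    congr 1; rw [hN, hu, hv]; field_simp; ring
  have c2 : c 2 = f (N * 10) := by
    simp only [c, slateCoeff, Matrix.cons_val]
    congr 1; rw [hN]; ring
  have c3 : c 3 = f (N * (7 * u + 3 * v)) := by
    simp only [c, slateCoeff, Matrix.cons_val]
    congr 1; rw [hN, hu, hv]; field_simp
  -- Independence of irrelevant alternatives: choosing `i` from three items means not choosing `k`,
  -- then choosing `i` from `{i, j}`.
  have hA : f (ai / (ai + aj + ak)) = f u * (1 - f (ak / (ai + aj + ak))) := by
    rw [← map_one f, ← map_sub, ← map_mul]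
    congr 1; rw [hu]; field_simp; ring
  have hB : f (bi / (bi + bj + bk)) = f v * (1 - f (bk / (bi + bj + bk))) := by
    rw [← map_one f, ← map_sub, ← map_mul]
    congr 1; rw [hv]; field_simp; ring
  rw [c0, c1, c2, c3]
  have hXj : Xi + Xj = 1 - Xk := by linear_combination hX
  have hYj : Yi + Yj = 1 - Yk := by linear_combination hY
  rw [hXj, hYj] at hij
  simp only [map_add _ (_ * _) (_ * _), map_mul, map_sub, map_one, map_ofNat, e7, e3] at hi hk hij ⊢
  have hYi : 3 * Yi = 3 * f (bi / (bi + bj + bk)) - 7 * di := by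
    simp only [di]
    linear_combination 10 * hi - (7 * Xi + 3 * Yi - 7 * f (ai / (ai + aj + ak))
      - 3 * f (bi / (bi + bj + bk))) * e10
  have hYk : 3 * Yk = 3 * f (bk / (bi + bj + bk)) - 7 * dk := by
    simp only [dk]
    linear_combination 10 * hk - (7 * Xk + 3 * Yk - 7 * f (ak / (ai + aj + ak))
      - 3 * f (bk / (bi + bj + bk))) * e10
  have hXi : Xi = f u * (1 - f (ak / (ai + aj + ak))) + di := by simp only [di]; rw [← hA]; ring
  have hXk : Xk = f (ak / (ai + aj + ak)) + dk := by simp only [dk]; ring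
  rw [hB] at hYi
  -- Scaling by 30 leaves `Y` only in the form `3 Y`, for which `hYi` and `hYk` are available.
  have key : 7 * Xi * (3 * (1 - Yk)) + 3 * (3 * Yi) * (1 - Xk)
      = (7 * f u + 3 * f v) * (1 - Xk) * (3 * (1 - Yk)) := by
    linear_combination 30 * hij - 3 * (7 * Xi * (1 - Yk) + 3 * Yi * (1 - Xk)
      - (7 * f u + 3 * f v) * (1 - Xk) * (1 - Yk)) * e10
  rw [mul_sub, mul_sub, hYk, hYi] at key
  rw [hXi, hXk] at key
  set E := 3 * ((1 - f (bk / (bi + bj + bk))) - (1 - f (ak / (ai + aj + ak)))) * di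
    + 3 * (f u * (1 - f (bk / (bi + bj + bk))) - f v * (1 - f (ak / (ai + aj + ak)))) * dk
    + dk * (10 * di + (7 * f u + 3 * f v) * dk) with hE
  -- The constant terms cancel because the true scores solve the equation.
  have h7 : 7 * E = 0 := by
    rw [hE]
    linear_combination key
  have hE0 : E = 0 := by linear_combination f (1 / 7) * h7 - E * e71
  rw [hE] at hE0
  clear_value N di dk
  linear_combination f N * hE0

/-- A point on three conics through the origin is the origin if the Bezout determinant of the
minors is not zero. -/
theorem eq_zero_of_conics {K : Type*} [Field K] {e f g : Fin 5 → K} {s t : K}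
    (h : bezoutCubic (conicMinor e f) (conicMinor e g) ≠ 0)
    (he : conic e s t = 0) (hf : conic f s t = 0) (hg : conic g s t = 0) : s = 0 ∧ t = 0 :=
  eq_zero_of_bezoutCubic_ne_zero _ _ h s t (conicMinor_eval_eq_zero _ _ _ _ he hf)
    (conicMinor_eval_eq_zero _ _ _ _ he hg)

/-- Over a local ring, two conics that cross transversally at the origin meet in no other point
of the maximal ideal. -/
theorem eq_zero_of_conics_of_mem_maximalIdeal {R : Type*} [CommRing R] [IsLocalRing R]
    {e f : Fin 5 → R} {s t : R} (h : IsUnit (e 0 * f 1 - e 1 * f 0))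
    (hs : s ∈ IsLocalRing.maximalIdeal R) (ht : t ∈ IsLocalRing.maximalIdeal R)
    (he : conic e s t = 0) (hf : conic f s t = 0) : s = 0 ∧ t = 0 := by
  simp only [conic] at he hf
  -- Factoring `s` and `t` out of the conics gives a square linear system in `(s, t)`. Its
  -- determinant agrees with the Jacobian modulo the maximal ideal, so it is a unit and Cramer's
  -- rule applies.
  have hu : IsUnit ((e 0 + e 2 * s) * (f 1 + f 3 * s + f 4 * t)
      - (e 1 + e 3 * s + e 4 * t) * (f 0 + f 2 * s)) := by
    by_contra hn
    rw [← mem_nonunits_iff, ← IsLocalRing.mem_maximalIdeal] at hn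
    refine (IsLocalRing.mem_maximalIdeal _).1 ?_ h
    have : e 0 * f 1 - e 1 * f 0 = ((e 0 + e 2 * s) * (f 1 + f 3 * s + f 4 * t)
      - (e 1 + e 3 * s + e 4 * t) * (f 0 + f 2 * s))
      - ((e 0 * f 3 + e 2 * (f 1 + f 3 * s + f 4 * t) - e 1 * f 2 - e 3 * (f 0 + f 2 * s)) * s
        + (e 0 * f 4 - e 4 * (f 0 + f 2 * s)) * t) := by ring
    rw [this]
    exact sub_mem hn (add_mem (Ideal.mul_mem_left _ _ hs) (Ideal.mul_mem_left _ _ ht))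
  constructor
  · refine (hu.mul_right_eq_zero).1 ?_
    linear_combination (f 1 + f 3 * s + f 4 * t) * he - (e 1 + e 3 * s + e 4 * t) * hf
  · refine (hu.mul_right_eq_zero).1 ?_
    linear_combination (e 0 + e 2 * s) * hf - (f 0 + f 2 * s) * he

end Conics

/-! ### The system over an arbitrary `ℂ`-algebra, so that `ℂ` and the local ring are treated alike.
-/

section System

variable {n : ℕ} {R : Type*} [CommRing R] [Algebra ℂ R]

/-- `(x, y)` solves the equations with cleared denominators in the `ℂ`-algebra `R`, the data
being the slate probabilities of the scores `a` and `b`. -/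
structure IsClearedSolution (a b : Fin n → ℝ) (x y : Fin n → R) : Prop where
  pair : ∀ i j, i ≠ j →
    algebraMap ℂ R (7 / 10) * x i * (y i + y j) + algebraMap ℂ R (3 / 10) * y i * (x i + x j) =
      algebraMap ℂ R (7 / 10 * (a i / (a i + a j)) + 3 / 10 * (b i / (b i + b j)))
        * (x i + x j) * (y i + y j)
  triple : ∀ i j k, Distinct₃ i j k →
    algebraMap ℂ R (7 / 10) * x i * (y i + y j + y k)
        + algebraMap ℂ R (3 / 10) * y i * (x i + x j + x k) =
      algebraMap ℂ R
          (7 / 10 * (a i / (a i + a j + a k)) + 3 / 10 * (b i / (b i + b j + b k)))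
        * (x i + x j + x k) * (y i + y j + y k)

variable {a b : Fin n → ℝ} {x y : Fin n → R} {o j k : Fin n} {s t : R}

/-- Dividing by both denominators, whose inverses are `s` and `t`, makes the equation linear. -/
theorem IsClearedSolution.normalized_triple (h : IsClearedSolution a b x y)
    (hd : Distinct₃ o j k) (hs : (x o + x j + x k) * s = 1) (ht : (y o + y j + y k) * t = 1) :
    algebraMap ℂ R (7 / 10) * (x o * s) + algebraMap ℂ R (3 / 10) * (y o * t) =
      algebraMap ℂ R
        (7 / 10 * (a o / (a o + a j + a k)) + 3 / 10 * (b o / (b o + b j + b k))) := by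
  have := h.triple o j k hd
  set e := algebraMap ℂ R
    (7 / 10 * (a o / (a o + a j + a k)) + 3 / 10 * (b o / (b o + b j + b k)))
  linear_combination s * t * this - algebraMap ℂ R (7 / 10) * x o * s * ht
    - algebraMap ℂ R (3 / 10) * y o * t * hs + e * (y o + y j + y k) * t * hs + e * ht

theorem IsClearedSolution.normalized_slate (h : IsClearedSolution a b x y)
    (ha : ∀ i, 0 < a i) (hb : ∀ i, 0 < b i)
    (hd : Distinct₃ o j k) (hs : (x o + x j + x k) * s = 1) (ht : (y o + y j + y k) * t = 1)
    {sa sb : ℂ} (hsa : (a o + a j + a k : ℂ) = sa) (hsb : (b o + b j + b k : ℂ) = sb) :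
    let c := fun l => algebraMap ℂ R (slateCoeff (a o : ℂ) (a j) (a k) (b o) (b j) (b k) l)
    let di := x o * s - algebraMap ℂ R (a o / sa)
    let dk := x k * s - algebraMap ℂ R (a k / sa)
    c 0 * di + c 1 * dk + dk * (c 2 * di + c 3 * dk) = 0 := by
  have hA := add_pos (add_pos (ha o) (ha j)) (ha k)
  have hB := add_pos (add_pos (hb o) (hb j)) (hb k)
  have ho := h.normalized_triple hd hs ht
  have hk := h.normalized_triple (o := k) (j := o) (k := j) (s := s) (t := t)
    ⟨hd.2.1.symm, hd.2.2.symm, hd.1⟩ (by linear_combination hs) (by linear_combination ht)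
  rw [hsa, hsb] at ho
  rw [add_rotate, hsa, add_rotate (b k : ℂ), hsb] at hk
  refine slate_equation (Xj := x j * s) (Yi := y o * t) (Yj := y j * t) (Yk := y k * t)
    hsa hsb ?_ ?_ ?_ ?_ ?_ ?_ ho hk ?_
  · rw [← hsa]; exact_mod_cast hA.ne'
  · rw [← hsb]; exact_mod_cast hB.ne'
  · exact_mod_cast (add_pos (ha o) (ha j)).ne'
  · exact_mod_cast (add_pos (hb o) (hb j)).ne'
  · linear_combination hs
  · linear_combination ht
  · linear_combination s * t * h.pair o j hd.1

/-- The deviation of the normalized scores lies on the three conics. -/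
theorem IsClearedSolution.conic_eq_zero (h : IsClearedSolution a b x y)
    (ha : ∀ i, 0 < a i) (hb : ∀ i, 0 < b i) (hd : Distinct₃ o j k)
    (hao : a o = 1) (hbo : b o = 1)
    (hs : (x o + x j + x k) * s = 1) (ht : (y o + y j + y k) * t = 1) (l : Fin 3) :
    conic (algebraMap ℂ R ∘ slateConic (a j : ℂ) (a k) (b j) (b k) l)
      (x j * s - algebraMap ℂ R (a j / (a o + a j + a k)))
      (x k * s - algebraMap ℂ R (a k / (a o + a j + a k))) = 0 := by
  obtain ⟨h1, h2, h3⟩ := hd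
  have hA : (a o + a j + a k : ℂ) ≠ 0 := by
    exact_mod_cast (add_pos (add_pos (ha o) (ha j)) (ha k)).ne'
  -- The three orderings of the items are those used in `slateConic`.
  have e0 := h.normalized_slate ha hb (o := j) (j := k) (k := o) (s := s) (t := t)
    ⟨h3, h1.symm, h2.symm⟩ (by linear_combination hs) (by linear_combination ht)
    (sa := a o + a j + a k) (by ring) rfl
  have e1 := h.normalized_slate ha hb (o := k) (j := o) (k := j) (s := s) (t := t)
    ⟨h2.symm, h3.symm, h1⟩ (by linear_combination hs) (by linear_combination ht)
    (sa := a o + a j + a k) (by ring) rfl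
  have e2 := h.normalized_slate ha hb (o := j) (j := o) (k := k) (s := s) (t := t)
    ⟨h1.symm, h3, h2⟩ (by linear_combination hs) (by linear_combination ht)
    (sa := a o + a j + a k) (by ring) rfl
  have hsum : algebraMap ℂ R (a o / (a o + a j + a k)) + algebraMap ℂ R (a j / (a o + a j + a k))
      + algebraMap ℂ R (a k / (a o + a j + a k)) = 1 := by
    rw [← map_add, ← map_add, ← map_one (algebraMap ℂ R)]
    congr 1
    field_simp
  have hd0 : x o * s - algebraMap ℂ R (a o / (a o + a j + a k)) =
      -(x j * s - algebraMap ℂ R (a j / (a o + a j + a k)))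
      - (x k * s - algebraMap ℂ R (a k / (a o + a j + a k))) := by
    linear_combination hs - hsum
  dsimp only at e0
  rw [hd0] at e0
  simp only [hao, hbo, Complex.ofReal_one] at e0 e1 e2 ⊢
  fin_cases l <;>
    simp only [conic, slateConic, Function.comp_apply, Fin.zero_eta, Fin.mk_one, Fin.reduceFinMk,
      Matrix.cons_val, map_sub, map_neg, map_mul, map_ofNat, map_zero]
  · linear_combination e0
  · linear_combination e1
  · linear_combination e2

/-- Normalized scores sum to one, so two of them fix the third. As `x o = 1`, the third is the scale
`s` itself, and dividing by it recovers the score. -/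
theorem eq_of_normalized_eq {c : Fin n → ℝ} (hc : ∀ i, 0 < c i) (hco : c o = 1) (hxo : x o = 1)
    (hs : (x o + x j + x k) * s = 1)
    (hj : x j * s = algebraMap ℂ R (c j / (c o + c j + c k)))
    (hk : x k * s = algebraMap ℂ R (c k / (c o + c j + c k))) : x j = algebraMap ℂ R (c j) := by
  have hC : (c o + c j + c k : ℂ) ≠ 0 := by
    exact_mod_cast (add_pos (add_pos (hc o) (hc j)) (hc k)).ne'
  rw [hco, Complex.ofReal_one] at hj hk hC
  have hs' : s = algebraMap ℂ R (1 / (1 + c j + c k)) := by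
    have : algebraMap ℂ R (1 / (1 + c j + c k)) + algebraMap ℂ R (c j / (1 + c j + c k))
        + algebraMap ℂ R (c k / (1 + c j + c k)) = 1 := by
      rw [← map_add, ← map_add, ← map_one (algebraMap ℂ R)]
      congr 1
      field_simp
    rw [hxo] at hs
    linear_combination hs - this - hj - hk
  have hunit : algebraMap ℂ R (1 / (1 + c j + c k)) * algebraMap ℂ R (1 + c j + c k) = 1 := by
    rw [← map_mul, ← map_one (algebraMap ℂ R)]
    congr 1
    field_simp
  have hj' : x j * algebraMap ℂ R (1 / (1 + c j + c k)) =
      algebraMap ℂ R (c j) * algebraMap ℂ R (1 / (1 + c j + c k)) := by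
    rw [← hs', hj, hs', ← map_mul]
    congr 1
    ring
  linear_combination algebraMap ℂ R (1 + c j + c k) * hj'
    + (algebraMap ℂ R (c j) - x j) * hunit

/-- If the normalized `x`-scores of one slate of size three are the true ones, then so are all
the scores of that slate. -/
theorem IsClearedSolution.eq_of_deviation_eq_zero (h : IsClearedSolution a b x y)
    (ha : ∀ i, 0 < a i) (hb : ∀ i, 0 < b i) (hd : Distinct₃ o j k)
    (hao : a o = 1) (hbo : b o = 1) (hxo : x o = 1) (hyo : y o = 1)
    (hs : (x o + x j + x k) * s = 1) (ht : (y o + y j + y k) * t = 1)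
    (hj : x j * s - algebraMap ℂ R (a j / (a o + a j + a k)) = 0)
    (hk : x k * s - algebraMap ℂ R (a k / (a o + a j + a k)) = 0) :
    x j = algebraMap ℂ R (a j) ∧ y j = algebraMap ℂ R (b j) := by
  refine ⟨eq_of_normalized_eq ha hao hxo hs (sub_eq_zero.1 hj) (sub_eq_zero.1 hk), ?_⟩
  have e3 : algebraMap ℂ R (10 / 3) * algebraMap ℂ R (3 / 10) = 1 := by
    rw [← map_mul]; norm_num
  obtain ⟨h1, h2, h3⟩ := hd
  have tj := h.normalized_triple (o := j) (j := k) (k := o) (s := s) (t := t)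
    ⟨h3, h1.symm, h2.symm⟩ (by linear_combination hs) (by linear_combination ht)
  have tk := h.normalized_triple (o := k) (j := o) (k := j) (s := s) (t := t)
    ⟨h2.symm, h3.symm, h1⟩ (by linear_combination hs) (by linear_combination ht)
  rw [← add_rotate, ← add_rotate (b o : ℂ), map_add, map_mul, map_mul] at tj
  rw [add_rotate, add_rotate (b k : ℂ), map_add, map_mul, map_mul] at tk
  refine eq_of_normalized_eq hb hbo hyo ht ?_ ?_
  · linear_combination algebraMap ℂ R (10 / 3) * tj
      - algebraMap ℂ R (10 / 3) * algebraMap ℂ R (7 / 10) * hj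
      - (y j * t - algebraMap ℂ R (b j / (b o + b j + b k))) * e3
  · linear_combination algebraMap ℂ R (10 / 3) * tk
      - algebraMap ℂ R (10 / 3) * algebraMap ℂ R (7 / 10) * hk
      - (y k * t - algebraMap ℂ R (b k / (b o + b j + b k))) * e3

/-- Uniqueness of the complex solution on a slate of size three. -/
theorem IsClearedSolution.eq_of_degeneracy_ne_zero {x y : Fin n → ℂ}
    (h : IsClearedSolution a b x y)
    (ha : ∀ i, 0 < a i) (hb : ∀ i, 0 < b i) (hd : Distinct₃ o j k)
    (hao : a o = 1) (hbo : b o = 1) (hxo : x o = 1) (hyo : y o = 1)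
    (hx : x o + x j + x k ≠ 0) (hy : y o + y j + y k ≠ 0)
    (hD : degeneracy (a j) (a k) (b j) (b k) ≠ 0) : x j = a j ∧ y j = b j := by
  have hs := mul_inv_cancel₀ hx
  have ht := mul_inv_cancel₀ hy
  have hD' : degeneracy (a j : ℂ) (a k) (b j) (b k) ≠ 0 := by
    have := map_degeneracy Complex.ofRealHom (a j) (a k) (b j) (b k)
    simp only [Complex.ofRealHom_eq_coe] at this
    rw [← this]
    exact_mod_cast hD
  have hcon := h.conic_eq_zero ha hb hd hao hbo hs ht
  obtain ⟨h1, h2⟩ := eq_zero_of_conics (right_ne_zero_of_mul hD') (hcon 1) (hcon 2) (hcon 0)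
  exact h.eq_of_deviation_eq_zero ha hb hd hao hbo hxo hyo hs ht h1 h2

/-- Infinitesimal uniqueness on a slate of size three, over a local `ℂ`-algebra. -/
theorem IsClearedSolution.eq_of_mem_maximalIdeal [IsLocalRing R]
    (h : IsClearedSolution a b x y)
    (ha : ∀ i, 0 < a i) (hb : ∀ i, 0 < b i) (hd : Distinct₃ o j k)
    (hao : a o = 1) (hbo : b o = 1) (hxo : x o = 1) (hyo : y o = 1)
    (hs : (x o + x j + x k) * s = 1) (ht : (y o + y j + y k) * t = 1)
    (hj : x j * s - algebraMap ℂ R (a j / (a o + a j + a k)) ∈ IsLocalRing.maximalIdeal R)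
    (hk : x k * s - algebraMap ℂ R (a k / (a o + a j + a k)) ∈ IsLocalRing.maximalIdeal R)
    (hD : degeneracy (a j) (a k) (b j) (b k) ≠ 0) :
    x j = algebraMap ℂ R (a j) ∧ y j = algebraMap ℂ R (b j) := by
  have hJ : jacobian (a j : ℂ) (a k) (b j) (b k) ≠ 0 := by
    have := map_jacobian Complex.ofRealHom (a j) (a k) (b j) (b k)
    simp only [Complex.ofRealHom_eq_coe] at this
    rw [← this]
    exact_mod_cast left_ne_zero_of_mul hD
  have hcon := h.conic_eq_zero ha hb hd hao hbo hs ht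
  have hunit := (isUnit_iff_ne_zero.2 hJ).map (algebraMap ℂ R)
  simp only [jacobian, map_sub, map_mul] at hunit
  obtain ⟨h1, h2⟩ := eq_zero_of_conics_of_mem_maximalIdeal hunit hj hk (hcon 1) (hcon 2)
  exact h.eq_of_deviation_eq_zero ha hb hd hao hbo hxo hyo hs ht h1 h2

end System

/-! ### The local ring of the solution scheme at a point. -/

section Multiplicity

open MvPolynomial

variable {σ : Type} (I : Ideal (MvPolynomial σ ℂ)) (z : σ → ℂ)

/-- The local ring at `z` of the scheme defined by `I`. -/
abbrev SolutionRing : Type :=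
  Localization.AtPrime (idealAt z) ⧸
    I.map (algebraMap (MvPolynomial σ ℂ) (Localization.AtPrime (idealAt z)))

/-- The germ at `z` of a polynomial, restricted to the scheme defined by `I`. -/
noncomputable def germ : MvPolynomial σ ℂ →ₐ[ℂ] SolutionRing I z :=
  (Ideal.Quotient.mkₐ ℂ _).comp
    (IsScalarTower.toAlgHom ℂ (MvPolynomial σ ℂ) (Localization.AtPrime (idealAt z)))

variable {I z}

theorem germ_apply (p : MvPolynomial σ ℂ) :
    germ I z p = Ideal.Quotient.mk _ (algebraMap _ (Localization.AtPrime (idealAt z)) p) := rfl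

theorem germ_eq_zero {p : MvPolynomial σ ℂ} (hp : p ∈ I) : germ I z p = 0 :=
  Ideal.Quotient.eq_zero_iff_mem.2 (Ideal.mem_map_of_mem _ hp)

theorem isUnit_germ {p : MvPolynomial σ ℂ} (hp : eval z p ≠ 0) : IsUnit (germ I z p) :=
  (IsLocalization.map_units (Localization.AtPrime (idealAt z))
    (⟨p, hp⟩ : (idealAt z).primeCompl)).map (Ideal.Quotient.mk _)

theorem map_le_maximalIdeal (hI : I ≤ idealAt z) :
    I.map (algebraMap (MvPolynomial σ ℂ) (Localization.AtPrime (idealAt z))) ≤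
      IsLocalRing.maximalIdeal (Localization.AtPrime (idealAt z)) := by
  rw [Ideal.map_le_iff_le_comap]
  exact fun p hp =>
    (IsLocalization.AtPrime.to_map_mem_maximal_iff _ (idealAt z) p).2 (hI hp)

theorem nontrivial_solutionRing (hI : I ≤ idealAt z) : Nontrivial (SolutionRing I z) :=
  Ideal.Quotient.nontrivial_iff.2 fun h =>
    Ideal.IsPrime.ne_top inferInstance (top_le_iff.1 (h ▸ map_le_maximalIdeal hI))

theorem isLocalRing_solutionRing (hI : I ≤ idealAt z) : IsLocalRing (SolutionRing I z) :=
  have := nontrivial_solutionRing hI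
  IsLocalRing.of_surjective' (Ideal.Quotient.mk _) Ideal.Quotient.mk_surjective

theorem germ_mem_maximalIdeal [IsLocalRing (SolutionRing I z)]
    {p : MvPolynomial σ ℂ} (hp : eval z p = 0) :
    germ I z p ∈ IsLocalRing.maximalIdeal (SolutionRing I z) := by
  have : IsLocalHom (Ideal.Quotient.mk
      (I.map (algebraMap (MvPolynomial σ ℂ) (Localization.AtPrime (idealAt z))))) :=
    Function.Surjective.isLocalHom _ Ideal.Quotient.mk_surjective
  rw [IsLocalRing.mem_maximalIdeal, mem_nonunits_iff, germ_apply]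
  intro hu
  exact (IsLocalRing.mem_maximalIdeal _).1
    ((IsLocalization.AtPrime.to_map_mem_maximal_iff _ (idealAt z) p).2 hp)
    (isUnit_of_map_unit _ _ hu)

/-- If every variable is constant on the scheme defined by `I` near its point `z`, then the
multiplicity of `z` is one. -/
theorem solutionMultiplicity_eq_one (hI : I ≤ idealAt z)
    (h : ∀ i, germ I z (X i) = algebraMap ℂ _ (z i)) : solutionMultiplicity I z = 1 := by
  have := nontrivial_solutionRing hI
  have hgerm : ∀ p, germ I z p = algebraMap ℂ (SolutionRing I z) (eval z p) := by
    have : germ I z = (Algebra.ofId ℂ (SolutionRing I z)).comp (aeval z) := by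
      ext i
      rw [h]
      simp [Algebra.ofId_apply]
    intro p
    rw [this]
    simp [Algebra.ofId_apply, MvPolynomial.aeval_eq_eval]
  -- Every element is a fraction `p / q` of germs with `q` nonzero at `z`, and both germs are
  -- constants.
  have hbij : Function.Bijective (Algebra.linearMap ℂ (SolutionRing I z)) := by
    refine ⟨(algebraMap ℂ (SolutionRing I z)).injective, fun r => ?_⟩
    obtain ⟨r, rfl⟩ := Ideal.Quotient.mk_surjective r
    obtain ⟨⟨p, q⟩, hpq⟩ := IsLocalization.surj (idealAt z).primeCompl r
    have hq : eval z (q : MvPolynomial σ ℂ) ≠ 0 := fun h0 => q.2 h0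
    refine ⟨eval z p / eval z (q : MvPolynomial σ ℂ), ?_⟩
    have h1 := congrArg (Ideal.Quotient.mk
      (I.map (algebraMap (MvPolynomial σ ℂ) (Localization.AtPrime (idealAt z))))) hpq
    rw [map_mul, ← germ_apply, ← germ_apply, hgerm, hgerm] at h1
    have hu : IsUnit (algebraMap ℂ (SolutionRing I z) (eval z (q : MvPolynomial σ ℂ))) :=
      (isUnit_iff_ne_zero.2 hq).map _
    refine hu.mul_right_cancel ?_
    rw [h1, Algebra.linearMap_apply, ← map_mul, div_mul_cancel₀ _ hq]
  have hrank : Module.rank ℂ (SolutionRing I z) = 1 := by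
    rw [← (LinearEquiv.ofBijective _ hbij).rank_eq, Module.rank_self]
  rw [solutionMultiplicity, hrank, map_one]

end Multiplicity

/-! ### Uniqueness and multiplicity one at nondegenerate parameters. -/

section Uniqueness

open MvPolynomial

variable {m : ℕ} {a b : Fin (m + 1) → ℝ}

theorem systemIdeal_le_idealAt (ha : ∀ i, 0 < a i) (hb : ∀ i, 0 < b i) (ha0 : a 0 = 1)
    (hb0 : b 0 = 1) (p₁ p₂ : ℝ) :
    systemIdeal p₁ p₂ (eta₂ p₁ p₂ a b) (eta₃ p₁ p₂ a b) ≤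
      idealAt (Sum.elim (fun i => (a i : ℂ)) (fun i => (b i : ℂ))) := by
  rw [systemIdeal, Ideal.span_le]
  rintro f (((rfl | rfl) | ⟨i, j, -, rfl⟩) | ⟨i, j, k, -, rfl⟩) <;>
    rw [SetLike.mem_coe, idealAt, RingHom.mem_ker]
  · simp [varX, ha0]
  · simp [varY, hb0]
  · have h1 : (a i + a j : ℂ) ≠ 0 := by exact_mod_cast (add_pos (ha i) (ha j)).ne'
    have h2 : (b i + b j : ℂ) ≠ 0 := by exact_mod_cast (add_pos (hb i) (hb j)).ne'
    simp only [pairPoly, eta₂, varX, varY, map_sub, map_add, map_mul, eval_C, eval_X,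
      Sum.elim_inl, Sum.elim_inr]
    push_cast
    field_simp
    ring
  · have h1 : (a i + a j + a k : ℂ) ≠ 0 := by
      exact_mod_cast (add_pos (add_pos (ha i) (ha j)) (ha k)).ne'
    have h2 : (b i + b j + b k : ℂ) ≠ 0 := by
      exact_mod_cast (add_pos (add_pos (hb i) (hb j)) (hb k)).ne'
    simp only [triplePoly, eta₃, varX, varY, map_sub, map_add, map_mul, eval_C, eval_X,
      Sum.elim_inl, Sum.elim_inr]
    push_cast
    field_simp
    ring

theorem IsSolution.isClearedSolution {x y : Fin (m + 1) → ℂ}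
    (h : IsSolution (7 / 10) (3 / 10) (eta₂ (7 / 10) (3 / 10) a b)
      (eta₃ (7 / 10) (3 / 10) a b) x y) : IsClearedSolution a b x y where
  pair i j hij := by
    have h1 := h.x_pair_ne i j hij
    have h2 := h.y_pair_ne i j hij
    have h3 := h.pair i j hij
    simp only [eta₂] at h3
    push_cast at h3
    simp only [Algebra.algebraMap_self, RingHom.id_apply]
    rw [← h3]
    field_simp
  triple i j k hd := by
    have h1 := h.x_triple_ne i j k hd
    have h2 := h.y_triple_ne i j k hd
    have h3 := h.triple i j k hd
    simp only [eta₃] at h3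
    push_cast at h3
    simp only [Algebra.algebraMap_self, RingHom.id_apply]
    rw [← h3]
    field_simp

theorem isSolution_self (ha : ∀ i, 0 < a i) (hb : ∀ i, 0 < b i) (ha0 : a 0 = 1)
    (hb0 : b 0 = 1) (p₁ p₂ : ℝ) :
    IsSolution p₁ p₂ (eta₂ p₁ p₂ a b) (eta₃ p₁ p₂ a b) (fun i => (a i : ℂ))
      (fun i => (b i : ℂ)) where
  x_first := by simp [ha0]
  y_first := by simp [hb0]
  x_pair_ne i j _ := by exact_mod_cast (add_pos (ha i) (ha j)).ne'
  y_pair_ne i j _ := by exact_mod_cast (add_pos (hb i) (hb j)).ne'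
  x_triple_ne i j k _ := by exact_mod_cast (add_pos (add_pos (ha i) (ha j)) (ha k)).ne'
  y_triple_ne i j k _ := by exact_mod_cast (add_pos (add_pos (hb i) (hb j)) (hb k)).ne'
  pair i j _ := by simp [eta₂]
  triple i j k _ := by simp [eta₃]

/-- The coordinate functions solve the system in the local ring of the solution scheme. -/
theorem isClearedSolution_germ (z : Fin (m + 1) ⊕ Fin (m + 1) → ℂ) :
    let I := systemIdeal (7 / 10) (3 / 10) (eta₂ (7 / 10) (3 / 10) a b)
      (eta₃ (7 / 10) (3 / 10) a b)
    IsClearedSolution a b (fun i => germ I z (varX i)) (fun i => germ I z (varY i)) := by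
  intro I
  have hC : ∀ c, germ I z (C c) = algebraMap ℂ _ c := fun c => by
    rw [← MvPolynomial.algebraMap_eq, AlgHom.commutes]
  constructor
  · intro i j hij
    have h := germ_eq_zero (I := I) (z := z)
      (Ideal.subset_span (Or.inl (Or.inr ⟨i, j, hij, rfl⟩)))
    simp only [pairPoly, map_sub, map_add, map_mul, hC, eta₂] at h
    push_cast at h
    simp only [map_add, map_mul] at h ⊢
    exact sub_eq_zero.1 h
  · intro i j k hd
    have h := germ_eq_zero (I := I) (z := z)
      (Ideal.subset_span (Or.inr ⟨i, j, k, hd, rfl⟩))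
    simp only [triplePoly, map_sub, map_add, map_mul, hC, eta₃] at h
    push_cast at h
    simp only [map_add, map_mul] at h ⊢
    exact sub_eq_zero.1 h

theorem germ_var_eq (ha : ∀ i, 0 < a i) (hb : ∀ i, 0 < b i) (ha0 : a 0 = 1) (hb0 : b 0 = 1)
    {j k : Fin (m + 1)} (hd : Distinct₃ 0 j k) (hD : degeneracy (a j) (a k) (b j) (b k) ≠ 0) :
    let I := systemIdeal (7 / 10) (3 / 10) (eta₂ (7 / 10) (3 / 10) a b)
      (eta₃ (7 / 10) (3 / 10) a b)
    let z : Fin (m + 1) ⊕ Fin (m + 1) → ℂ := Sum.elim (fun i => (a i : ℂ)) (fun i => (b i : ℂ))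
    germ I z (varX j) = algebraMap ℂ _ (a j : ℂ) ∧ germ I z (varY j) = algebraMap ℂ _ (b j : ℂ) := by
  intro I z
  have hI : I ≤ idealAt z := systemIdeal_le_idealAt ha hb ha0 hb0 _ _
  have := isLocalRing_solutionRing hI
  have hsys : IsClearedSolution a b (fun i => germ I z (varX i)) (fun i => germ I z (varY i)) :=
    isClearedSolution_germ z
  have hX : ∀ i, eval z (varX i) = (a i : ℂ) := fun i => by simp [varX, z]
  have hY : ∀ i, eval z (varY i) = (b i : ℂ) := fun i => by simp [varY, z]
  have hA : (a 0 + a j + a k : ℂ) ≠ 0 := by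
    exact_mod_cast (add_pos (add_pos (ha 0) (ha j)) (ha k)).ne'
  have hB : (b 0 + b j + b k : ℂ) ≠ 0 := by
    exact_mod_cast (add_pos (add_pos (hb 0) (hb j)) (hb k)).ne'
  have hx0 : germ I z (varX 0) = 1 := by
    have h := germ_eq_zero (I := I) (z := z) (p := varX 0 - 1)
      (Ideal.subset_span (Or.inl (Or.inl (Or.inl rfl))))
    rwa [map_sub, map_one, sub_eq_zero] at h
  have hy0 : germ I z (varY 0) = 1 := by
    have h := germ_eq_zero (I := I) (z := z) (p := varY 0 - 1)
      (Ideal.subset_span (Or.inl (Or.inl (Or.inr rfl))))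
    rwa [map_sub, map_one, sub_eq_zero] at h
  obtain ⟨s, hs⟩ := (isUnit_germ (I := I) (z := z) (p := varX 0 + varX j + varX k)
    (by simpa only [map_add, hX] using hA)).exists_right_inv
  obtain ⟨t, ht⟩ := (isUnit_germ (I := I) (z := z) (p := varY 0 + varY j + varY k)
    (by simpa only [map_add, hY] using hB)).exists_right_inv
  simp only [map_add] at hs ht
  have hmem : ∀ i, germ I z (varX i) * s - algebraMap ℂ _ ((a i : ℂ) / (a 0 + a j + a k)) ∈
      IsLocalRing.maximalIdeal (SolutionRing I z) := by
    intro i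
    -- The deviation times the slate sum is a polynomial vanishing at `z`; multiplying its germ by
    -- `s` gives back the deviation.
    have h := germ_mem_maximalIdeal (I := I) (z := z)
      (p := varX i - C ((a i : ℂ) / (a 0 + a j + a k)) * (varX 0 + varX j + varX k))
      (by simp only [map_sub, map_mul, map_add, hX, eval_C]; field_simp; ring)
    have h' := Ideal.mul_mem_left _ s h
    convert h' using 1
    rw [map_sub, map_mul, ← MvPolynomial.algebraMap_eq, AlgHom.commutes]
    simp only [map_add]
    linear_combination (algebraMap ℂ (SolutionRing I z) ((a i : ℂ) / (a 0 + a j + a k))) * hs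
  exact hsys.eq_of_mem_maximalIdeal ha hb hd ha0 hb0 hx0 hy0 hs ht (hmem j) (hmem k) hD

/-- Away from the degenerate parameters, the system has exactly one solution, of multiplicity
one. -/
theorem uniqueSolution_of_degeneracy_ne_zero (ha : ∀ i, 0 < a i) (hb : ∀ i, 0 < b i)
    (ha0 : a 0 = 1) (hb0 : b 0 = 1)
    (hD : ∀ j, j ≠ 0 → ∃ k, Distinct₃ 0 j k ∧ degeneracy (a j) (a k) (b j) (b k) ≠ 0) :
    UniqueSolutionWithMultiplicity (7 / 10) (3 / 10) (eta₂ (7 / 10) (3 / 10) a b)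
      (eta₃ (7 / 10) (3 / 10) a b) (fun i => (a i : ℂ)) (fun i => (b i : ℂ)) := by
  constructor
  · refine Set.Subset.antisymm ?_ (Set.singleton_subset_iff.2 (isSolution_self ha hb ha0 hb0 _ _))
    rintro ⟨x, y⟩ (h : IsSolution _ _ _ _ x y)
    have key : ∀ j, x j = a j ∧ y j = b j := by
      intro j
      by_cases hj : j = 0
      · subst hj
        simp [h.x_first, h.y_first, ha0, hb0]
      · obtain ⟨k, hd, hDk⟩ := hD j hj
        exact h.isClearedSolution.eq_of_degeneracy_ne_zero ha hb hd ha0 hb0 h.x_first h.y_first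
          (h.x_triple_ne _ _ _ hd) (h.y_triple_ne _ _ _ hd) hDk
    exact Prod.ext (funext fun j => (key j).1) (funext fun j => (key j).2)
  · have hI := systemIdeal_le_idealAt ha hb ha0 hb0 (7 / 10) (3 / 10)
    refine solutionMultiplicity_eq_one hI ?_
    rintro (j | j) <;> by_cases hj : j = 0
    · subst hj
      have h := germ_eq_zero (z := Sum.elim (fun i => (a i : ℂ)) (fun i => (b i : ℂ)))
        (I := systemIdeal (7 / 10) (3 / 10) (eta₂ (7 / 10) (3 / 10) a b)
          (eta₃ (7 / 10) (3 / 10) a b)) (p := varX 0 - 1)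
        (Ideal.subset_span (Or.inl (Or.inl (Or.inl rfl))))
      rw [map_sub, map_one, sub_eq_zero] at h
      simpa [varX, ha0] using h
    · obtain ⟨k, hd, hDk⟩ := hD j hj
      exact (germ_var_eq ha hb ha0 hb0 hd hDk).1
    · subst hj
      have h := germ_eq_zero (z := Sum.elim (fun i => (a i : ℂ)) (fun i => (b i : ℂ)))
        (I := systemIdeal (7 / 10) (3 / 10) (eta₂ (7 / 10) (3 / 10) a b)
          (eta₃ (7 / 10) (3 / 10) a b)) (p := varY 0 - 1)
        (Ideal.subset_span (Or.inl (Or.inl (Or.inr rfl))))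
      rw [map_sub, map_one, sub_eq_zero] at h
      simpa [varY, hb0] using h
    · obtain ⟨k, hd, hDk⟩ := hD j hj
      exact (germ_var_eq ha hb ha0 hb0 hd hDk).2

end Uniqueness

/-! ### Degenerate parameters are null, and identifiability follows. -/

section Generic

open MvPolynomial

variable {m : ℕ}

theorem scores_pos {v : Fin m → ℝ} (hv : ∀ i, 0 < v i) (i : Fin (m + 1)) : 0 < scores v i := by
  refine Fin.cases ?_ (fun i => ?_) i
  · simp [scores]
  · simpa [scores] using hv i

/-- The parameters for which some slate `{1, j, k}` is degenerate. -/
def degenerateSet (m : ℕ) : Set ((Fin m → ℝ) × (Fin m → ℝ)) :=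
  ⋃ j : Fin m, ⋃ k : {k : Fin m // j ≠ k},
    {θ | degeneracy (θ.1 j) (θ.1 k) (θ.2 j) (θ.2 k) = 0}

theorem volume_degenerateSet : volume (degenerateSet m) = 0 := by
  refine measure_iUnion_null fun j => measure_iUnion_null fun ⟨k, hjk⟩ => ?_
  let P : MvPolynomial (Fin m ⊕ Fin m) ℝ :=
    degeneracy (X (Sum.inl j)) (X (Sum.inl k)) (X (Sum.inr j)) (X (Sum.inr k))
  have hev : ∀ v, eval v P = degeneracy (v (Sum.inl j)) (v (Sum.inl k)) (v (Sum.inr j))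
      (v (Sum.inr k)) := fun v => by
    rw [map_degeneracy (eval v)]
    simp only [eval_X]
  have hP : P ≠ 0 := by
    intro h0
    have h1 := hev (Sum.elim (Pi.single j 1) (Pi.single k 1))
    rw [h0, map_zero] at h1
    simp only [Sum.elim_inl, Sum.elim_inr, Pi.single_eq_same, Pi.single_eq_of_ne hjk,
      Pi.single_eq_of_ne hjk.symm] at h1
    exact degeneracy_sample_ne_zero h1.symm
  simpa only [hev, Sum.elim_inl, Sum.elim_inr] using volume_zeros_prod P hP

theorem uniqueSolution_of_notMem_degenerateSet (hm : 2 ≤ m) {θ : (Fin m → ℝ) × (Fin m → ℝ)}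
    (h1 : ∀ i, 0 < θ.1 i) (h2 : ∀ i, 0 < θ.2 i) (hθ : θ ∉ degenerateSet m) :
    UniqueSolutionWithMultiplicity (7 / 10) (3 / 10)
      (eta₂ (7 / 10) (3 / 10) (scores θ.1) (scores θ.2))
      (eta₃ (7 / 10) (3 / 10) (scores θ.1) (scores θ.2))
      (fun i => ((scores θ.1 i : ℝ) : ℂ)) (fun i => ((scores θ.2 i : ℝ) : ℂ)) := by
  refine uniqueSolution_of_degeneracy_ne_zero (scores_pos h1) (scores_pos h2) rfl rfl ?_
  intro j hj
  obtain ⟨j, rfl⟩ := Fin.exists_succ_eq.2 hj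
  -- Having at least three items is what supplies the third item `k`.
  have : Nontrivial (Fin m) := Fin.nontrivial_iff_two_le.2 hm
  obtain ⟨k, hk⟩ := exists_ne j
  refine ⟨k.succ, ⟨(Fin.succ_ne_zero j).symm, (Fin.succ_ne_zero k).symm,
    fun h => hk (Fin.succ_injective _ h).symm⟩, fun h => hθ ?_⟩
  simp only [degenerateSet, Set.mem_iUnion]
  exact ⟨j, ⟨k, hk.symm⟩, h⟩

/-- A competing parameter in `Q` is positive, so its denominators do not vanish and it is itself a
complex solution of the system. -/
theorem notMem_nonIdentifiable {Q : Set ((Fin m → ℝ) × (Fin m → ℝ))}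
    (hQ : ∀ θ ∈ Q, (∀ i, 0 < θ.1 i) ∧ ∀ i, 0 < θ.2 i) {p₁ p₂ : ℝ}
    {θ : (Fin m → ℝ) × (Fin m → ℝ)}
    (h : UniqueSolutionWithMultiplicity p₁ p₂
      (eta₂ p₁ p₂ (scores θ.1) (scores θ.2)) (eta₃ p₁ p₂ (scores θ.1) (scores θ.2))
      (fun i => ((scores θ.1 i : ℝ) : ℂ)) (fun i => ((scores θ.2 i : ℝ) : ℂ))) :
    θ ∉ nonIdentifiable p₁ p₂ Q := by
  rintro ⟨-, θ', hθ', hne, h2, h3⟩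
  obtain ⟨ha, hb⟩ := hQ θ' hθ'
  have hs := isSolution_self (scores_pos ha) (scores_pos hb) rfl rfl p₁ p₂
  have hs' : ((fun i => ((scores θ'.1 i : ℝ) : ℂ)), (fun i => ((scores θ'.2 i : ℝ) : ℂ))) ∈
      {z : (Fin (m + 1) → ℂ) × (Fin (m + 1) → ℂ) | IsSolution p₁ p₂
        (eta₂ p₁ p₂ (scores θ.1) (scores θ.2)) (eta₃ p₁ p₂ (scores θ.1) (scores θ.2))
        z.1 z.2} :=
    { hs with
      pair := fun i j hij => by rw [← h2 i j hij]; exact hs.pair i j hij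
      triple := fun i j k hd => by rw [← h3 i j k hd]; exact hs.triple i j k hd }
  rw [h.1, Set.mem_singleton_iff, Prod.mk.injEq] at hs'
  refine hne (Prod.ext (funext fun i => ?_) (funext fun i => ?_))
  · simpa [scores] using congrFun hs'.1 i.succ
  · simpa [scores] using congrFun hs'.2 i.succ

theorem volume_box_pos {rA RA rB RB : Fin m → ℝ} (hA : ∀ i, rA i < RA i)
    (hB : ∀ i, rB i < RB i) : 0 < volume (box rA RA rB RB) := by
  rw [box, Measure.volume_eq_prod, Measure.prod_prod, Real.volume_Icc_pi, Real.volume_Icc_pi]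
  refine ENNReal.mul_pos (Finset.prod_ne_zero_iff.2 fun i _ => ?_)
    (Finset.prod_ne_zero_iff.2 fun i _ => ?_)
  · simpa using hA i
  · simpa using hB i

end Generic

end MNLMixture

theorem mainTheorem10 (m : ℕ) (hm : 3 ≤ m + 1) (rA RA rB RB : Fin m → ℝ)
    (hrA : ∀ i, 0 < rA i) (hA : ∀ i, rA i < RA i)
    (hrB : ∀ i, 0 < rB i) (hB : ∀ i, rB i < RB i) :
    volume {θ ∈ MNLMixture.box rA RA rB RB |
      ¬ MNLMixture.UniqueSolutionWithMultiplicity (7 / 10) (3 / 10)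
          (MNLMixture.eta₂ (7 / 10) (3 / 10)
            (MNLMixture.scores θ.1) (MNLMixture.scores θ.2))
          (MNLMixture.eta₃ (7 / 10) (3 / 10)
            (MNLMixture.scores θ.1) (MNLMixture.scores θ.2))
          (fun i => ((MNLMixture.scores θ.1 i : ℝ) : ℂ))
          (fun i => ((MNLMixture.scores θ.2 i : ℝ) : ℂ))} = 0 ∧
    MNLMixture.GenericallyIdentifiable (7 / 10) (3 / 10) (MNLMixture.box rA RA rB RB) := by
  have hpos : ∀ θ ∈ MNLMixture.box rA RA rB RB, (∀ i, 0 < θ.1 i) ∧ ∀ i, 0 < θ.2 i :=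
    fun θ hθ => ⟨fun i => (hrA i).trans_le (hθ.1.1 i), fun i => (hrB i).trans_le (hθ.2.1 i)⟩
  have hunique := fun θ (hθ : θ ∈ MNLMixture.box rA RA rB RB) =>
    MNLMixture.uniqueSolution_of_notMem_degenerateSet (Nat.le_of_succ_le_succ hm)
      (hpos θ hθ).1 (hpos θ hθ).2
  refine ⟨measure_mono_null ?_ MNLMixture.volume_degenerateSet,
    MNLMixture.volume_box_pos hA hB, measure_mono_null ?_ MNLMixture.volume_degenerateSet⟩
  · rintro θ ⟨hθ, hn⟩
    by_contra hdeg
    exact hn (hunique θ hθ hdeg)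
  · intro θ hθ
    by_contra hdeg
    exact MNLMixture.notMem_nonIdentifiable hpos (hunique θ hθ.1 hdeg) hθ
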